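/- Let $\mathcal C$ be a variety of universal algebras (the category of all algebras for a given set of finitary operations satisfying a given set of identities, with all homomorphisms), and suppose that $\mathcal C$ is semi-abelian: it is pointed, regular and finitely cocomplete, every internal equivalence relation in $\mathcal C$ is a kernel pair, and the Split Short Five Lemma holds in $\mathcal C$. Let $A$ be an object of $\mathcal C$; an object $Z$ of $\mathcal C$ is called $A$-null if $\operatorname{Hom}(A,Z)=0$, i.e. every morphism $A\to Z$ is zero. Then the $A$-nullification functor exists: there are a functor $P_A\colon\mathcal C\to\mathcal C$ and a natural transformation $\eta\colon 1_{\mathcal C}\Rightarrow P_A$ such that $P_A\eta=\eta P_A$ is an isomorphism and such that, for every object $X$, the object $P_A X$ is $A$-null and every morphism $X\to Z$ to an $A$-null object $Z$ factors uniquely through $\eta_X\colon X\to P_A X$. Moreover, for every such pair $(P_A,\eta)$ and every object $X$ of $\mathcal C$, the coaugmentation $\eta_X\colon X\to P_A X$ is a normal epimorphism, i.e. a cokernel of some morphism. -/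

import Mathlib

open CategoryTheory CategoryTheory.Limits

universe s r w v u

/-! ### Varieties of universal algebras -/

/-- An algebra in the variety (finitary equational class) presented by a signature `L` (a language
without relation symbols) and a set `E` of identities between terms in countably many variables:
a set with an interpretation of every operation symbol, in which all identities of `E` hold under
every assignment of values to the variables. -/
structure VarietyAlgebra (L : FirstOrder.Language.{s, r}) [L.IsAlgebraic]
    (E : Set (L.Term ℕ × L.Term ℕ)) where
  /-- the underlying set -/
  carrier : Type w
  /-- the operations -/
  [str : L.Structure carrier]
  /-- the identities -/
  sat : ∀ e ∈ E, ∀ x : ℕ → carrier, e.1.realize x = e.2.realize x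

attribute [instance] VarietyAlgebra.str

/-- The category of algebras of a variety; morphisms are the maps that commute with all
operations. -/
instance VarietyAlgebra.instCategory (L : FirstOrder.Language.{s, r}) [L.IsAlgebraic]
    (E : Set (L.Term ℕ × L.Term ℕ)) : Category (VarietyAlgebra.{s, r, w} L E) where
  Hom X Y := FirstOrder.Language.Hom L X.carrier Y.carrier
  id X := FirstOrder.Language.Hom.id L X.carrier
  comp f g := FirstOrder.Language.Hom.comp g f

/-! ### Homological and semi-abelian categories -/

/-- The Split Short Five Lemma holds in `C`: for a morphism `(u, v, w)` between split epimorphisms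
`f`, `f'` with given sections `t`, `t'` and kernels `k`, `k'`, if `u` and `w` are isomorphisms, then
so is `v`. -/
def SplitShortFiveLemma (C : Type u) [Category.{v} C] [HasZeroMorphisms C] : Prop :=
  ∀ ⦃K A B K' A' B' : C⦄ (k : K ⟶ A) (f : A ⟶ B) (t : B ⟶ A)
    (k' : K' ⟶ A') (f' : A' ⟶ B') (t' : B' ⟶ A')
    (hk : k ≫ f = 0) (hk' : k' ≫ f' = 0)
    (_ : Nonempty (IsLimit (KernelFork.ofι k hk)))
    (_ : Nonempty (IsLimit (KernelFork.ofι k' hk')))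
    (_ : t ≫ f = 𝟙 B) (_ : t' ≫ f' = 𝟙 B')
    (u : K ⟶ K') (v : A ⟶ A') (w : B ⟶ B')
    (_ : k ≫ v = u ≫ k') (_ : f ≫ w = v ≫ f') (_ : t ≫ v = w ≫ t')
    (_ : IsIso u) (_ : IsIso w), IsIso v

/-- A homological category: a pointed regular category in which the Split Short Five Lemma
holds. -/
class HomologicalCategory (C : Type u) [Category.{v} C] [HasZeroMorphisms C] : Prop
    extends Regular C, HasZeroObject C where
  splitShortFive : SplitShortFiveLemma C

/-- A semi-abelian category: a finitely cocomplete homological category in which every internal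
equivalence relation is the kernel pair of some morphism. -/
class SemiAbelianCategory (C : Type u) [Category.{v} C] [HasZeroMorphisms C] : Prop
    extends HomologicalCategory C where
  hasFiniteColimits : HasFiniteColimits C
  isKernelPair_of_isEquivalenceRelation : ∀ ⦃R X : C⦄ (p q : R ⟶ X),
    IsEquivalenceRelation p q → ∃ (Y : C) (f : X ⟶ Y), IsKernelPair f p q

/-! ### Localization functors and nullification -/

/-- A localization functor: an idempotent co-augmented endofunctor `(P, η)`, that is, `Pη = ηP` and
this natural transformation `P ⟶ PP` is an isomorphism. -/
structure IsLocalizationFunctor {C : Type u} [Category.{v} C] (P : C ⥤ C) (η : 𝟭 C ⟶ P) :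
    Prop where
  map_eq : ∀ X : C, P.map (η.app X) = η.app (P.obj X)
  isIso_map : ∀ X : C, IsIso (P.map (η.app X))

/-- `Z` is `A`-null: `Hom(A, Z) = 0`. -/
def IsNullObject {C : Type u} [Category.{v} C] [HasZeroMorphisms C] (A Z : C) : Prop :=
  ∀ f : A ⟶ Z, f = 0

/-- `(P, η)` is the `A`-nullification functor: it is the localization functor associated with the
full subcategory of `A`-null objects, with `η_X : X ⟶ P X` the reflection of `X` in this
subcategory. -/
structure IsNullification {C : Type u} [Category.{v} C] [HasZeroMorphisms C] (A : C)
    (P : C ⥤ C) (η : 𝟭 C ⟶ P) : Prop extends IsLocalizationFunctor P η where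
  isNull : ∀ X : C, IsNullObject A (P.obj X)
  existsUnique_fac : ∀ (X Z : C), IsNullObject A Z → ∀ f : X ⟶ Z,
    ∃! g : P.obj X ⟶ Z, η.app X ≫ g = f

/-! ### Regular epimorphisms in homological categories are normal -/

section Homological

variable {C : Type u} [Category.{v} C] [HasZeroMorphisms C]

/-! `A`-null algebras are closed under subalgebras, and the intersection of all congruences on `X`
with `A`-null quotient again has an `A`-null quotient. That quotient is therefore the reflection of
`X`, and its projection is surjective. Reflections are unique up to isomorphism, so every
nullification has surjective coaugmentations (`surjective_of_isNullification`). A surjection is the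
coequalizer of its kernel congruence, hence a regular epimorphism, and the Split Short Five Lemma
turns regular epimorphisms into cokernels of their kernels
(`HomologicalCategory.nonempty_normalEpi`). -/

/-- In a homological category, a morphism that vanishes on the kernel of `f` coequalizes the kernel
pair of `f`. -/
theorem HomologicalCategory.pullback_fst_comp_eq_snd_comp [HomologicalCategory C] {X Y Z : C}
    (f : X ⟶ Y) (h : X ⟶ Z) (hh : kernel.ι f ≫ h = 0) :
    pullback.fst f f ≫ h = pullback.snd f f ≫ h := by
  let ι := equalizer.ι (pullback.fst f f ≫ h) (pullback.snd f f ≫ h)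
  -- The kernel of the first projection of the kernel pair is `Ker f`, embedded as `(0, k)`.
  let k' : kernel f ⟶ pullback f f := pullback.lift 0 (kernel.ι f) (by simp)
  have hk'1 : k' ≫ pullback.fst f f = 0 := pullback.lift_fst _ _ _
  have hk'2 : k' ≫ pullback.snd f f = kernel.ι f := pullback.lift_snd _ _ _
  let d : X ⟶ pullback f f := pullback.lift (𝟙 X) (𝟙 X) rfl
  have hd1 : d ≫ pullback.fst f f = 𝟙 X := pullback.lift_fst _ _ _
  have hd2 : d ≫ pullback.snd f f = 𝟙 X := pullback.lift_snd _ _ _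
  let k : kernel f ⟶ equalizer (pullback.fst f f ≫ h) (pullback.snd f f ≫ h) :=
    equalizer.lift k' (by rw [reassoc_of% hk'1, reassoc_of% hk'2, hh, zero_comp])
  let t : X ⟶ equalizer (pullback.fst f f ≫ h) (pullback.snd f f ≫ h) :=
    equalizer.lift d (by rw [reassoc_of% hd1, reassoc_of% hd2])
  have hk : k ≫ ι = k' := equalizer.lift_ι _ _
  have ht : t ≫ ι = d := equalizer.lift_ι _ _
  have : Mono k' := mono_of_mono_fac hk'2
  have : Mono k := mono_of_mono_fac hk
  have lift {W : C} (a : W ⟶ pullback f f) (ha : a ≫ pullback.fst f f = 0) :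
      ∃ l, l ≫ k' = a := by
    refine ⟨kernel.lift f (a ≫ pullback.snd f f) ?_, ?_⟩
    · rw [Category.assoc, ← pullback.condition, reassoc_of% ha, zero_comp]
    · apply pullback.hom_ext
      · rw [Category.assoc, hk'1, comp_zero, ha]
      · rw [Category.assoc, hk'2, kernel.lift_ι]
  have hkι : k ≫ ι ≫ pullback.fst f f = 0 := by rw [reassoc_of% hk, hk'1]
  have limit' : IsLimit (KernelFork.ofι k' hk'1) :=
    KernelFork.IsLimit.ofι' _ _ fun a ha => ⟨(lift a ha).choose, (lift a ha).choose_spec⟩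
  have limit : IsLimit (KernelFork.ofι k hkι) := by
    refine KernelFork.IsLimit.ofι' _ _ fun a ha => ?_
    have hl := lift (a ≫ ι) (by rw [Category.assoc, ha])
    refine ⟨hl.choose, ?_⟩
    rw [← cancel_mono ι, Category.assoc, hk, hl.choose_spec]
  -- The equalizer contains the diagonal and `(0, Ker f)`, so over `X` it is split by the same
  -- section and has the same kernel as the whole kernel pair.
  have : IsIso ι := HomologicalCategory.splitShortFive k (ι ≫ pullback.fst f f) t k'
    (pullback.fst f f) d hkι hk'1 ⟨limit⟩ ⟨limit'⟩ (by rw [reassoc_of% ht, hd1]) hd1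
    (𝟙 _) ι (𝟙 _) (by rw [hk, Category.id_comp]) (Category.comp_id _)
    (by rw [ht, Category.id_comp]) inferInstance inferInstance
  rw [← cancel_epi ι]
  exact equalizer.condition _ _

/-- In a homological category, every regular epimorphism is the cokernel of its kernel. -/
theorem HomologicalCategory.nonempty_normalEpi [HomologicalCategory C] {X Y : C} (f : X ⟶ Y)
    [IsRegularEpi f] : Nonempty (NormalEpi f) := by
  have fac {Z : C} (h : X ⟶ Z) (hh : kernel.ι f ≫ h = 0) : ∃ g, f ≫ g = h :=
    IsRegularEpi.exists_of_isKernelPair f (IsPullback.of_hasPullback f f) h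
      (HomologicalCategory.pullback_fst_comp_eq_snd_comp f h hh)
  exact ⟨{ W := kernel f
           g := kernel.ι f
           w := kernel.condition f
           isColimit := CokernelCofork.IsColimit.ofπ' _ _ fun h hh =>
            ⟨(fac h hh).choose, (fac h hh).choose_spec⟩ }⟩

end Homological

/-! ### Nullifications from objectwise reflections -/

section Reflection

variable {C : Type u} [Category.{v} C] [HasZeroMorphisms C]

/-- Objectwise reflections into the `A`-null objects assemble into an `A`-nullification functor. -/
theorem exists_isNullification_of_reflections (A : C) (Q : C → C) (e : ∀ X, X ⟶ Q X)
    (hQ : ∀ X, IsNullObject A (Q X))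
    (he : ∀ (X Z : C), IsNullObject A Z → ∀ f : X ⟶ Z, ∃! g : Q X ⟶ Z, e X ≫ g = f) :
    ∃ (P : C ⥤ C) (η : 𝟭 C ⟶ P), IsNullification A P η := by
  have ext {X Z : C} (hZ : IsNullObject A Z) {a b : Q X ⟶ Z} (h : e X ≫ a = e X ≫ b) : a = b :=
    (he X Z hZ (e X ≫ b)).unique h rfl
  choose desc fac _ using he
  let P : C ⥤ C :=
    { obj := Q
      map := fun {X Y} f => desc X (Q Y) (hQ Y) (f ≫ e Y)
      map_id := fun X => ext (hQ X) (by simp [fac])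
      map_comp := fun {X Y Z} f g => ext (hQ Z) (by
        rw [fac, ← Category.assoc, fac, Category.assoc, Category.assoc, fac]) }
  let η : 𝟭 C ⟶ P :=
    { app := e
      naturality := fun X Y f => (fac X (Q Y) (hQ Y) (f ≫ e Y)).symm }
  have map_eq (X : C) : P.map (η.app X) = η.app (P.obj X) :=
    ext (hQ (Q X)) (fac _ _ _ _)
  refine ⟨P, η, ⟨⟨map_eq, fun X => ?_⟩, hQ, fun X Z hZ f => ⟨desc X Z hZ f, fac _ _ _ _, ?_⟩⟩⟩
  · rw [map_eq]
    -- The inverse of `e (Q X)` extends the identity of the null object `Q X`.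
    have h : e (Q X) ≫ desc (Q X) (Q X) (hQ X) (𝟙 _) = 𝟙 _ := fac _ _ _ _
    refine ⟨desc (Q X) (Q X) (hQ X) (𝟙 _), h, ext (hQ (Q X)) ?_⟩
    change e (Q X) ≫ desc _ _ _ _ ≫ e (Q X) = e (Q X) ≫ 𝟙 _
    rw [reassoc_of% h, Category.comp_id]
  · exact fun g hg => ext hZ (hg.trans (fac X Z hZ f).symm)

end Reflection

/-! ### Congruences, quotients and surjections in a variety -/

namespace VarietyAlgebra

open FirstOrder Language

variable {L : FirstOrder.Language.{s, r}} [L.IsAlgebraic] {E : Set (L.Term ℕ × L.Term ℕ)}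

/-- The underlying map of a morphism of algebras. -/
def toFun {X Y : VarietyAlgebra.{s, r, w} L E} (f : X ⟶ Y) : X.carrier → Y.carrier :=
  FirstOrder.Language.Hom.toFun f

theorem toFun_funMap {X Y : VarietyAlgebra.{s, r, w} L E} (f : X ⟶ Y) {n : ℕ} (o : L.Functions n)
    (x : Fin n → X.carrier) :
    toFun f (Structure.funMap o x) = Structure.funMap o (fun i => toFun f (x i)) :=
  FirstOrder.Language.Hom.map_fun' f o x

@[simp]
theorem toFun_comp {X Y Z : VarietyAlgebra.{s, r, w} L E} (f : X ⟶ Y) (g : Y ⟶ Z)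
    (x : X.carrier) : toFun (f ≫ g) x = toFun g (toFun f x) :=
  rfl

@[simp]
theorem toFun_id {X : VarietyAlgebra.{s, r, w} L E} (x : X.carrier) : toFun (𝟙 X) x = x :=
  rfl

theorem hom_ext {X Y : VarietyAlgebra.{s, r, w} L E} {f g : X ⟶ Y}
    (h : ∀ x, toFun f x = toFun g x) : f = g :=
  FirstOrder.Language.Hom.ext h

/-- Construct a morphism of algebras from a map that commutes with the operations. -/
def homMk {X Y : VarietyAlgebra.{s, r, w} L E} (f : X.carrier → Y.carrier)
    (hf : ∀ {n : ℕ} (o : L.Functions n) (x : Fin n → X.carrier),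
      f (Structure.funMap o x) = Structure.funMap o (fun i => f (x i))) : X ⟶ Y :=
  ({ toFun := f
     map_fun' := hf
     map_rel' := fun q => isEmptyElim q } : X.carrier →[L] Y.carrier)

/-- The kernel congruence of a morphism, as a subalgebra of the square of its domain. -/
def kernelPair {X Y : VarietyAlgebra.{s, r, w} L E} (f : X ⟶ Y) :
    VarietyAlgebra.{s, r, w} L E :=
  letI str : L.Structure {p : X.carrier × X.carrier // toFun f p.1 = toFun f p.2} :=
    { funMap := fun o x => ⟨(Structure.funMap o fun i => (x i).1.1,
        Structure.funMap o fun i => (x i).1.2), by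
          simp only [toFun_funMap, (x _).2]⟩
      RelMap := fun q => isEmptyElim q }
  { carrier := {p : X.carrier × X.carrier // toFun f p.1 = toFun f p.2}
    str := str
    sat := fun e he x => by
      have h1 := X.sat e he fun i => (x i).1.1
      have h2 := X.sat e he fun i => (x i).1.2
      let p : {p : X.carrier × X.carrier // toFun f p.1 = toFun f p.2} →[L] X.carrier :=
        { toFun := fun a => a.1.1
          map_fun' := fun _ _ => rfl
          map_rel' := fun q => isEmptyElim q }
      let q : {p : X.carrier × X.carrier // toFun f p.1 = toFun f p.2} →[L] X.carrier :=
        { toFun := fun a => a.1.2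
          map_fun' := fun _ _ => rfl
          map_rel' := fun q => isEmptyElim q }
      refine Subtype.ext (Prod.ext ?_ ?_)
      · have := (HomClass.realize_term p (t := e.1) (v := x)).symm.trans
          (h1.trans (HomClass.realize_term p (t := e.2) (v := x)))
        exact this
      · have := (HomClass.realize_term q (t := e.1) (v := x)).symm.trans
          (h2.trans (HomClass.realize_term q (t := e.2) (v := x)))
        exact this }

/-- A morphism factors through a surjective one as soon as it is compatible with its kernel
congruence. -/
theorem exists_fac_of_surjective {X Y Z : VarietyAlgebra.{s, r, w} L E} (f : X ⟶ Y)
    (hf : Function.Surjective (toFun f)) (h : X ⟶ Z)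
    (hh : ∀ x y, toFun f x = toFun f y → toFun h x = toFun h y) : ∃ g : Y ⟶ Z, f ≫ g = h := by
  have key (x : X.carrier) :
      toFun h (Function.surjInv hf (toFun f x)) = toFun h x :=
    hh _ _ (Function.surjInv_eq hf _)
  refine ⟨homMk (fun y => toFun h (Function.surjInv hf y)) fun o y => ?_, hom_ext key⟩
  rw [← toFun_funMap, ← key (Structure.funMap o _), toFun_funMap]
  simp only [Function.surjInv_eq hf]

theorem epi_of_surjective {X Y : VarietyAlgebra.{s, r, w} L E} (f : X ⟶ Y)
    (hf : Function.Surjective (toFun f)) : Epi f where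
  left_cancellation g h hgh := hom_ext fun y => by
    obtain ⟨x, rfl⟩ := hf y
    rw [← toFun_comp, hgh, toFun_comp]

theorem mono_of_injective {X Y : VarietyAlgebra.{s, r, w} L E} (f : X ⟶ Y)
    (hf : Function.Injective (toFun f)) : Mono f where
  right_cancellation g h hgh := hom_ext fun y => hf <| by
    rw [← toFun_comp, hgh, toFun_comp]

/-- Surjective morphisms of algebras are regular epimorphisms. -/
theorem isRegularEpi_of_surjective {X Y : VarietyAlgebra.{s, r, w} L E} (f : X ⟶ Y)
    (hf : Function.Surjective (toFun f)) : IsRegularEpi f := by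
  have := epi_of_surjective f hf
  let p : kernelPair f ⟶ X := homMk (fun a => a.1.1) fun _ _ => rfl
  let q : kernelPair f ⟶ X := homMk (fun a => a.1.2) fun _ _ => rfl
  have fac {Z : VarietyAlgebra.{s, r, w} L E} (h : X ⟶ Z) (hh : p ≫ h = q ≫ h) :
      ∃ g, f ≫ g = h :=
    exists_fac_of_surjective f hf h fun x y hxy =>
      congrArg (fun k : kernelPair f ⟶ Z => toFun k ⟨(x, y), hxy⟩) hh
  exact ⟨⟨{ W := kernelPair f
            left := p
            right := q
            w := hom_ext fun a => a.2
            isColimit := Cofork.IsColimit.mk _ (fun c => (fac c.π c.condition).choose)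
              (fun c => (fac c.π c.condition).choose_spec)
              (fun c m hm => by
                rw [← cancel_epi f]
                exact hm.trans (fac c.π c.condition).choose_spec.symm) }⟩⟩

/-- A congruence: an equivalence relation that is compatible with the operations. -/
structure Congruence (X : VarietyAlgebra.{s, r, w} L E) extends Setoid X.carrier where
  funMap_rel : ∀ {n : ℕ} (o : L.Functions n) (x y : Fin n → X.carrier),
    (∀ i, toSetoid.r (x i) (y i)) → toSetoid.r (Structure.funMap o x) (Structure.funMap o y)

namespace Congruence

variable {X : VarietyAlgebra.{s, r, w} L E}

/-- The structure of an algebra on the quotient by a congruence. -/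
@[reducible]
def prestructure (c : Congruence X) : L.Prestructure c.toSetoid where
  toStructure := X.str
  fun_equiv := fun x y h => c.funMap_rel _ x y h
  rel_equiv := fun {_ q} _ _ _ => isEmptyElim q

/-- The quotient of an algebra by a congruence. -/
def quotient (c : Congruence X) : VarietyAlgebra.{s, r, w} L E :=
  letI := c.prestructure
  { carrier := Quotient c.toSetoid
    sat := fun e he x => by
      -- Choosing representatives reduces an identity in the quotient to the same identity in `X`.
      have hx : x = fun i => (⟦(x i).out⟧ : Quotient c.toSetoid) :=
        funext fun i => (Quotient.out_eq _).symm
      rw [hx]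
      exact (Term.realize_quotient_mk' c.toSetoid e.1 _).trans
        ((congrArg _ (X.sat e he _)).trans (Term.realize_quotient_mk' c.toSetoid e.2 _).symm) }

/-- The projection to the quotient by a congruence. -/
def proj (c : Congruence X) : X ⟶ c.quotient :=
  homMk (fun x => Quotient.mk c.toSetoid x) fun o x =>
    letI := c.prestructure
    (funMap_quotient_mk' c.toSetoid o x).symm

theorem proj_surjective (c : Congruence X) : Function.Surjective (toFun c.proj) :=
  Quotient.mk_surjective

theorem toFun_proj_eq_iff (c : Congruence X) {x y : X.carrier} :
    toFun c.proj x = toFun c.proj y ↔ c.toSetoid.r x y :=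
  Quotient.eq

/-- The kernel congruence of a morphism. -/
def ker {Y : VarietyAlgebra.{s, r, w} L E} (f : X ⟶ Y) : Congruence X where
  toSetoid := Setoid.ker (toFun f)
  funMap_rel o x y h := by
    change toFun f _ = toFun f _
    rw [toFun_funMap, toFun_funMap]
    exact congrArg _ (funext h)

variable [HasZeroMorphisms (VarietyAlgebra.{s, r, w} L E)]

/-- The smallest congruence whose quotient is `A`-null: the intersection of all the congruences with
an `A`-null quotient. -/
def nullification (A X : VarietyAlgebra.{s, r, w} L E) : Congruence X where
  r x y := ∀ c : Congruence X, IsNullObject A c.quotient → c.toSetoid.r x y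
  iseqv := ⟨fun x c _ => c.refl x, fun h c hc => c.symm (h c hc),
    fun h h' c hc => c.trans (h c hc) (h' c hc)⟩
  funMap_rel o x y h c hc := c.funMap_rel o x y fun i => h i c hc

/-- For each congruence `c` with null quotient, the composite of `f` with the map onto `c.quotient`
is zero. So representatives of `f a` and of the zero morphism's value at `a` are related by every
such `c`, hence by their intersection. -/
theorem isNullObject_quotient_nullification (A X : VarietyAlgebra.{s, r, w} L E) :
    IsNullObject A (nullification A X).quotient := by
  refine fun f => hom_ext fun a => ?_
  obtain ⟨x, hx⟩ := (nullification A X).proj_surjective (toFun f a)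
  obtain ⟨y, hy⟩ := (nullification A X).proj_surjective
    (toFun (0 : A ⟶ (nullification A X).quotient) a)
  rw [← hx, ← hy, toFun_proj_eq_iff]
  intro c hc
  obtain ⟨g, hg⟩ := exists_fac_of_surjective _ (nullification A X).proj_surjective c.proj
    fun x y hxy => c.toFun_proj_eq_iff.2 ((nullification A X).toFun_proj_eq_iff.1 hxy c hc)
  rw [← toFun_proj_eq_iff, ← hg, toFun_comp, toFun_comp, hx, hy, ← toFun_comp, ← toFun_comp,
    hc (f ≫ g), zero_comp]

/-- The quotient by the kernel congruence of a morphism to an `A`-null object is `A`-null. -/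
theorem isNullObject_quotient_ker {A Z : VarietyAlgebra.{s, r, w} L E} (hZ : IsNullObject A Z)
    (f : X ⟶ Z) : IsNullObject A (ker f).quotient := by
  obtain ⟨m, hm⟩ := exists_fac_of_surjective _ (ker f).proj_surjective f
    fun x y hxy => (ker f).toFun_proj_eq_iff.1 hxy
  have : Mono m := mono_of_injective m fun a b hab => by
    obtain ⟨x, rfl⟩ := (ker f).proj_surjective a
    obtain ⟨y, rfl⟩ := (ker f).proj_surjective b
    rw [← toFun_comp, ← toFun_comp, hm] at hab
    exact (ker f).toFun_proj_eq_iff.2 hab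
  intro g
  rw [← cancel_mono m, zero_comp, hZ (g ≫ m)]

/-- The kernel congruence of `f` is one of those being intersected, so `f` is constant on the
classes of the intersection. -/
theorem existsUnique_proj_nullification_comp {A Z : VarietyAlgebra.{s, r, w} L E}
    (hZ : IsNullObject A Z) (f : X ⟶ Z) :
    ∃! g : (nullification A X).quotient ⟶ Z, (nullification A X).proj ≫ g = f := by
  have := epi_of_surjective _ (nullification A X).proj_surjective
  obtain ⟨g, hg⟩ := exists_fac_of_surjective _ (nullification A X).proj_surjective f
    fun x y hxy => (nullification A X).toFun_proj_eq_iff.1 hxy _ (isNullObject_quotient_ker hZ f)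
  exact ⟨g, hg, fun g' hg' => (cancel_epi (nullification A X).proj).1 (hg'.trans hg.symm)⟩

end Congruence

/-- The coaugmentation of every `A`-nullification functor on a variety is surjective. -/
theorem surjective_of_isNullification [HasZeroMorphisms (VarietyAlgebra.{s, r, w} L E)]
    {A : VarietyAlgebra.{s, r, w} L E}
    {P : VarietyAlgebra.{s, r, w} L E ⥤ VarietyAlgebra.{s, r, w} L E}
    {η : 𝟭 (VarietyAlgebra.{s, r, w} L E) ⟶ P} (h : IsNullification A P η)
    (X : VarietyAlgebra.{s, r, w} L E) : Function.Surjective (toFun (η.app X)) := by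
  let c := Congruence.nullification A X
  obtain ⟨a, ha, -⟩ := h.existsUnique_fac X c.quotient
    (Congruence.isNullObject_quotient_nullification A X) c.proj
  obtain ⟨b, hb, -⟩ := Congruence.existsUnique_proj_nullification_comp (h.isNull X) (η.app X)
  -- This makes `b` surjective, and `η.app X` is `c.proj` followed by `b`.
  have hab : a ≫ b = 𝟙 (P.obj X) :=
    (h.existsUnique_fac X _ (h.isNull X) (η.app X)).unique
      (by rw [reassoc_of% ha]; exact hb) (Category.comp_id _)
  intro y
  obtain ⟨x, hx⟩ := c.proj_surjective (toFun a y)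
  refine ⟨x, ?_⟩
  have hbx : toFun (η.app X) x = toFun b (toFun c.proj x) :=
    congrArg (fun k => toFun k x) hb.symm
  rw [hbx, hx, ← toFun_comp, hab, toFun_id]

end VarietyAlgebra

theorem proposition7p1 (L : FirstOrder.Language.{s, r}) [L.IsAlgebraic] (E : Set (L.Term ℕ × L.Term ℕ))
    [HasZeroMorphisms (VarietyAlgebra.{s, r, w} L E)]
    [SemiAbelianCategory (VarietyAlgebra.{s, r, w} L E)]
    (A : VarietyAlgebra.{s, r, w} L E) :
    (∃ (P : VarietyAlgebra.{s, r, w} L E ⥤ VarietyAlgebra.{s, r, w} L E)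
      (η : 𝟭 (VarietyAlgebra.{s, r, w} L E) ⟶ P), IsNullification A P η) ∧
    ∀ (P : VarietyAlgebra.{s, r, w} L E ⥤ VarietyAlgebra.{s, r, w} L E)
      (η : 𝟭 (VarietyAlgebra.{s, r, w} L E) ⟶ P), IsNullification A P η →
      ∀ X : VarietyAlgebra.{s, r, w} L E, Nonempty (NormalEpi (η.app X)) := by
  refine ⟨exists_isNullification_of_reflections A
    (fun X => (VarietyAlgebra.Congruence.nullification A X).quotient)
    (fun X => (VarietyAlgebra.Congruence.nullification A X).proj)
    (VarietyAlgebra.Congruence.isNullObject_quotient_nullification A)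
    (fun _ _ hZ f => VarietyAlgebra.Congruence.existsUnique_proj_nullification_comp hZ f),
    fun P η h X => ?_⟩
  have := VarietyAlgebra.isRegularEpi_of_surjective (η.app X)
    (VarietyAlgebra.surjective_of_isNullification h X)
  exact HomologicalCategory.nonempty_normalEpi (η.app X)
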